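/- Let $0\le q<n$ and identify covectors on $\mathbb R^{n+1}$ with vectors by the Euclidean inner product, so that $T^*S^n=\{(x,\xi)\in\mathbb R^{n+1}\times\mathbb R^{n+1}: |x|=1,\ \langle x,\xi\rangle=0\}$. Identify $T^*S^n$ with the complex quadric $Q=\{z\in\mathbb C^{n+1}:\sum_{k=0}^n z_k^2=1\}$ via $$\Psi(x,\xi)=x\cosh|\xi|+i\,\frac{\xi}{|\xi|}\sinh|\xi| ,\qquad \Psi(x,0)=x .$$ The Stenzel Kähler form is $\omega_{\mathrm{St}}=\tfrac i2\,\partial\bar\partial\, v(|z|^2)$ restricted to $Q$, that is, on tangent vectors of $Q$, $$\omega_{\mathrm{St}}=\frac i2\sum_{j,k=0}^n\bigl(v'(|z|^2)\,\delta_{jk}+v''(|z|^2)\,\bar z_jz_k\bigr)\,dz_j\wedge d\bar z_k ,$$ where $v$ on $[1,\infty)$ is the Stenzel potential: $v(\cosh w)=f(w)$ for $w\ge 0$, where $f(0)=f'(0)=0$, $f'(w)>0$ for $w>0$, and $$\frac{d}{dw}\bigl(f'(w)\bigr)^n=n\,c\,(\sinh w)^{n-1}$$ for some fixed constant $c>0$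 (this makes the Kähler metric Ricci-flat). Let $x:L\to S^n$ be a smooth immersion of a smooth $q$-dimensional manifold $L$ (oriented or not), and let $\mu\in\Omega^1(L)$ be a smooth $1$-form. For $p\in L$ let $N^*_pL=\{\xi\in T^*_{x(p)}S^n:\xi\circ d_px=0\}$, and regard $\mu(p)\in T^*_pL$ as an element of $T^*_{x(p)}S^n$ by identifying $T_pL$ with $d_px(T_pL)$ and extending by zero on the normal space of $L$. The twisted conormal bundle is the $n$-dimensional immersed submanifold $$N^*L+\mu=\{(p,\xi+\mu(p)) : p\in L,\ \xi\in N^*_pL\}$$ of $T^*S^n$, immersed by $(p,\eta)\mapsto(x(p),\eta)$. Then $N^*L+\mu$ is Lagrangian in $(T^*S^n,\omega_{\mathrm{St}})$, i.e. $\omega_{\mathrm{St}}$ vanishes on all its tangent spaces, if and only if $\mu=0$. -/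

import Mathlib

open Set Filter Function Manifold Metric
open scoped ContDiff InnerProductSpace

noncomputable section

namespace StenzelConormal

/-- The Euclidean space `ℝ^{n+1}` containing the unit sphere `S^n`.  The dual `(ℝ^{n+1})^*` is
identified with it through the Euclidean inner product, so a covector is a vector here. -/
abbrev Ambient (n : ℕ) : Type := EuclideanSpace ℝ (Fin (n + 1))

/-- The unit sphere `S^n ⊂ ℝ^{n+1}`, with its standard smooth structure. -/
abbrev USphere (n : ℕ) : Type := sphere (0 : Ambient n) 1

/-- `T^*S^n = {(x, ξ) : |x| = 1, ξ(x) = 0} ⊂ ℝ^{n+1} ⊕ (ℝ^{n+1})^*`. -/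
def cotangentSphere (n : ℕ) : Set (Ambient n × Ambient n) :=
  {p | ‖p.1‖ = 1 ∧ ⟪p.1, p.2⟫_ℝ = 0}

/-- The affine quadric `Q = {z ∈ ℂ^{n+1} : ∑ z_k ^ 2 = 1}`. -/
def quadric (n : ℕ) : Set (Fin (n + 1) → ℂ) := {z | ∑ k, z k ^ 2 = 1}

/-- The tangent space `T_z Q = {Z ∈ ℂ^{n+1} : ∑ z_k Z_k = 0}`. -/
def tangentQuadric {n : ℕ} (z : Fin (n + 1) → ℂ) : Set (Fin (n + 1) → ℂ) :=
  {Z | ∑ k, z k * Z k = 0}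

/-- The identification `Ψ : T^*S^n → Q`, `(x, ξ) ↦ x cosh |ξ| + i (ξ / |ξ|) sinh |ξ|`
(the second summand is `0` when `ξ = 0`). -/
def toQuadric {n : ℕ} (p : Ambient n × Ambient n) : Fin (n + 1) → ℂ := fun k =>
  ((p.1 k * Real.cosh ‖p.2‖ : ℝ) : ℂ) + Complex.I * ((p.2 k / ‖p.2‖ * Real.sinh ‖p.2‖ : ℝ) : ℂ)

theorem sum_sq_eq_norm_sq {n : ℕ} (x : Ambient n) : ∑ k, x k ^ 2 = ‖x‖ ^ 2 := by
  rw [EuclideanSpace.norm_sq_eq]; simp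

theorem toQuadric_mem_quadric {n : ℕ} {p : Ambient n × Ambient n} (hp : p ∈ cotangentSphere n) :
    toQuadric p ∈ quadric n := by
  obtain ⟨h1, h2⟩ := hp
  have h1' : ∑ k, p.1 k ^ 2 = 1 := by rw [sum_sq_eq_norm_sq, h1]; norm_num
  have h2' : ∑ k, p.1 k * p.2 k = 0 := by
    rw [← h2, PiLp.inner_apply]; simp [mul_comm]
  have h3 : (∑ k, p.2 k ^ 2) / ‖p.2‖ ^ 2 * Real.sinh ‖p.2‖ ^ 2 = Real.sinh ‖p.2‖ ^ 2 := by
    rw [sum_sq_eq_norm_sq]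
    rcases eq_or_ne ‖p.2‖ 0 with h | h
    · simp [h]
    · field_simp
  have key : ∀ k, toQuadric p k ^ 2 =
      ((p.1 k ^ 2 * Real.cosh ‖p.2‖ ^ 2 - p.2 k ^ 2 / ‖p.2‖ ^ 2 * Real.sinh ‖p.2‖ ^ 2 : ℝ) : ℂ)
      + Complex.I * ((2 * (p.1 k * p.2 k) * (Real.cosh ‖p.2‖ * Real.sinh ‖p.2‖ / ‖p.2‖) : ℝ) : ℂ) := by
    intro k
    simp only [toQuadric, add_sq, mul_pow, Complex.I_sq]
    push_cast
    ring
  have e1 : ∑ k, (p.1 k ^ 2 * Real.cosh ‖p.2‖ ^ 2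
      - p.2 k ^ 2 / ‖p.2‖ ^ 2 * Real.sinh ‖p.2‖ ^ 2) = 1 := by
    rw [Finset.sum_sub_distrib, ← Finset.sum_mul, ← Finset.sum_mul, ← Finset.sum_div, h1', h3]
    linarith [Real.cosh_sq ‖p.2‖]
  have e2 : ∑ k, 2 * (p.1 k * p.2 k) * (Real.cosh ‖p.2‖ * Real.sinh ‖p.2‖ / ‖p.2‖) = 0 := by
    rw [← Finset.sum_mul, ← Finset.mul_sum, h2']; ring
  show ∑ k, toQuadric p k ^ 2 = 1
  simp only [key]
  rw [Finset.sum_add_distrib, ← Finset.mul_sum, ← Complex.ofReal_sum, ← Complex.ofReal_sum, e1, e2]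
  simp

/-- `f'(w) = (n c ∫_0^w sinh^{n-1} t dt)^{1/n}`, the solution of Stenzel's equation
`((f')^n)' = n c sinh^{n-1}` with `f'(0) = 0`. -/
def potentialSlope (n : ℕ) (c w : ℝ) : ℝ :=
  (n * c * ∫ t in (0 : ℝ)..w, Real.sinh t ^ (n - 1)) ^ (1 / n : ℝ)

/-- The Stenzel potential `v` on `[1, ∞)`, as a function of `τ = |z|^2`, normalised by `c > 0`:
`v(cosh w) = f(w) = ∫_0^w f'(s) ds`. -/
def stenzelPotential (n : ℕ) (c τ : ℝ) : ℝ :=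
  ∫ s in (0 : ℝ)..Real.arcosh τ, potentialSlope n c s

theorem continuous_potentialSlope {n : ℕ} (c : ℝ) :
    Continuous (potentialSlope n c) := by
  unfold potentialSlope
  refine Continuous.rpow_const ?_ (fun _ => Or.inr (by positivity))
  refine continuous_const.mul ?_
  exact intervalIntegral.continuous_primitive
    (fun a b => ((Real.continuous_sinh.pow _).intervalIntegrable a b)) 0

/-- `v` solves the Ricci-flatness equation: `d/dw (d/dw v(cosh w))^n = n c sinh^{n-1} w`. -/
theorem stenzelPotential_ode {n : ℕ} (hn : 0 < n) {c : ℝ} (hc : 0 < c) {w : ℝ} (hw : 0 < w) :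
    HasDerivAt (fun s => deriv (fun t => stenzelPotential n c (Real.cosh t)) s ^ n)
      (n * c * Real.sinh w ^ (n - 1)) w := by
  have hsinh : Continuous fun t => Real.sinh t ^ (n - 1) := Real.continuous_sinh.pow _
  have h1 : ∀ s, 0 < s →
      deriv (fun t => stenzelPotential n c (Real.cosh t)) s = potentialSlope n c s := by
    intro s hs
    have : (fun t => stenzelPotential n c (Real.cosh t)) =ᶠ[nhds s]
        fun t => ∫ r in (0 : ℝ)..t, potentialSlope n c r := by
      filter_upwards [lt_mem_nhds hs] with t ht
      simp only [stenzelPotential, Real.arcosh_cosh ht.le]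
    rw [this.deriv_eq]
    exact (continuous_potentialSlope c).deriv_integral _ _ _
  have h2 : (fun s => deriv (fun t => stenzelPotential n c (Real.cosh t)) s ^ n) =ᶠ[nhds w]
      fun s => n * c * ∫ t in (0 : ℝ)..s, Real.sinh t ^ (n - 1) := by
    filter_upwards [lt_mem_nhds hw] with s hs
    rw [h1 s hs, potentialSlope, ← Real.rpow_natCast, ← Real.rpow_mul, one_div,
      inv_mul_cancel₀ (by positivity), Real.rpow_one]
    refine mul_nonneg (by positivity) (intervalIntegral.integral_nonneg hs.le ?_)
    intro t ht
    exact pow_nonneg (Real.sinh_nonneg_iff.2 ht.1) _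
  refine HasDerivAt.congr_of_eventuallyEq ?_ h2
  exact (hsinh.integral_hasStrictDerivAt 0 w).hasDerivAt.const_mul _

/-- `v'(τ)`, for `τ ∈ [1, ∞)` (one-sided at the end point `τ = 1`). -/
def potentialD1 (n : ℕ) (c : ℝ) : ℝ → ℝ := derivWithin (stenzelPotential n c) (Ici 1)

/-- `v''(τ)`, for `τ ∈ [1, ∞)` (one-sided at the end point `τ = 1`). -/
def potentialD2 (n : ℕ) (c : ℝ) : ℝ → ℝ := derivWithin (potentialD1 n c) (Ici 1)

/-- `(dz_j ∧ d\bar z_k)(Z, W)`. -/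
def dzWedgeDzbar {m : ℕ} (j k : Fin m) (Z W : Fin m → ℂ) : ℂ :=
  Z j * star (W k) - W j * star (Z k)

theorem sum_sum_dzWedgeDzbar {m : ℕ} (a b Z W : Fin m → ℂ) :
    ∑ j, ∑ k, a j * b k * dzWedgeDzbar j k Z W =
      (∑ j, a j * Z j) * (∑ k, b k * star (W k)) - (∑ j, a j * W j) * (∑ k, b k * star (Z k)) := by
  rw [Finset.sum_mul_sum, Finset.sum_mul_sum, ← Finset.sum_sub_distrib]
  refine Finset.sum_congr rfl fun j _ => ?_
  rw [← Finset.sum_sub_distrib]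
  refine Finset.sum_congr rfl fun k _ => ?_
  simp only [dzWedgeDzbar]
  ring

/-- `|z|^2`. -/
def sqNorm {m : ℕ} (z : Fin m → ℂ) : ℝ := ∑ k, Complex.normSq (z k)

/-- The Stenzel Kähler form `ω_St = (i/2) ∂∂̄ v(|z|^2)` at `z ∈ Q`, applied to `Z, W ∈ T_z Q`:
`(i/2) ∑_{j,k=0}^n (v' δ_{jk} + v'' \bar z_j z_k) dz_j ∧ d\bar z_k` with `v', v''` at `|z|^2`. -/
def stenzelForm (n : ℕ) (c : ℝ) (z Z W : Fin (n + 1) → ℂ) : ℂ :=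
  Complex.I / 2 * ∑ j, ∑ k,
    ((if j = k then (potentialD1 n c (sqNorm z) : ℂ) else 0)
      + star (z j) * z k * (potentialD2 n c (sqNorm z) : ℂ)) * dzWedgeDzbar j k Z W

/-- Where `z_0 ≠ 0`, the functions `z_1, …, z_n` are local coordinates of `Q`, and there
`ω_St = (i/2) ∑_{j,k=1}^n a_{jk} dz_j ∧ d\bar z_k` with
`a_{jk} = (δ_{jk} + z_j \bar z_k / |z_0|^2) v' + 2 Re(\bar z_j z_k - (\bar z_0 / z_0) z_j z_k) v''`. -/
theorem stenzelForm_eq_local {n : ℕ} (c : ℝ) {z Z W : Fin (n + 1) → ℂ} (h0 : z 0 ≠ 0)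
    (hZ : Z ∈ tangentQuadric z) (hW : W ∈ tangentQuadric z) :
    stenzelForm n c z Z W = Complex.I / 2 * ∑ j : Fin n, ∑ k : Fin n,
      (((if j = k then 1 else 0) + z j.succ * star (z k.succ) / (Complex.normSq (z 0) : ℂ))
          * (potentialD1 n c (sqNorm z) : ℂ)
        + 2 * ((star (z j.succ) * z k.succ - star (z 0) / z 0 * z j.succ * z k.succ).re : ℂ)
          * (potentialD2 n c (sqNorm z) : ℂ)) * dzWedgeDzbar j.succ k.succ Z W := by
  simp only [tangentQuadric, mem_ofPred_eq, Fin.sum_univ_succ] at hZ hW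
  have h0' : star (z 0) ≠ 0 := star_ne_zero.2 h0
  have hZ' : ∑ j : Fin n, z j.succ * Z j.succ = -(z 0 * Z 0) := by linear_combination hZ
  have hW' : ∑ j : Fin n, z j.succ * W j.succ = -(z 0 * W 0) := by linear_combination hW
  have hZs : ∑ j : Fin n, star (z j.succ) * star (Z j.succ) = -(star (z 0) * star (Z 0)) := by
    simpa [mul_comm] using congrArg star hZ'
  have hWs : ∑ j : Fin n, star (z j.succ) * star (W j.succ) = -(star (z 0) * star (W 0)) := by
    simpa [mul_comm] using congrArg star hW'
  unfold stenzelForm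
  generalize potentialD1 n c (sqNorm z) = d1
  generalize potentialD2 n c (sqNorm z) = d2
  have hre : ∀ u : ℂ, 2 * (u.re : ℂ) = u + star u := fun u => by
    rw [Complex.star_def, Complex.add_conj]; push_cast; ring
  have hnorm : (Complex.normSq (z 0) : ℂ) = z 0 * star (z 0) := by
    rw [Complex.star_def, Complex.mul_conj]
  have hL : ∑ j, ∑ k, ((if j = k then (d1 : ℂ) else 0) + star (z j) * z k * (d2 : ℂ))
        * dzWedgeDzbar j k Z W =
      d1 * ∑ j, dzWedgeDzbar j j Z W
        + d2 * ∑ j, ∑ k, star (z j) * z k * dzWedgeDzbar j k Z W := by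
    simp only [add_mul, Finset.sum_add_distrib, ite_mul, zero_mul, Finset.sum_ite_eq,
      Finset.mem_univ, if_true, Finset.mul_sum]
    congr 1
    refine Finset.sum_congr rfl fun j _ => Finset.sum_congr rfl fun k _ => ?_
    ring
  have hR : ∀ j k : Fin n,
      (((if j = k then 1 else 0) + z j.succ * star (z k.succ) / (Complex.normSq (z 0) : ℂ)) * (d1 : ℂ)
        + 2 * ((star (z j.succ) * z k.succ - star (z 0) / z 0 * z j.succ * z k.succ).re : ℂ)
          * (d2 : ℂ)) * dzWedgeDzbar j.succ k.succ Z W =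
      (if j = k then (d1 : ℂ) * dzWedgeDzbar j.succ k.succ Z W else 0)
        + (d1 / (z 0 * star (z 0)))
            * (z j.succ * star (z k.succ) * dzWedgeDzbar j.succ k.succ Z W)
        + d2 * (star (z j.succ) * z k.succ * dzWedgeDzbar j.succ k.succ Z W)
        + d2 * (z j.succ * star (z k.succ) * dzWedgeDzbar j.succ k.succ Z W)
        - d2 * star (z 0) / z 0 * (z j.succ * z k.succ * dzWedgeDzbar j.succ k.succ Z W)
        - d2 * z 0 / star (z 0)
            * (star (z j.succ) * star (z k.succ) * dzWedgeDzbar j.succ k.succ Z W) := by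
    intro j k
    rw [hre, hnorm]
    simp only [star_sub, star_mul', star_div₀, star_star]
    split_ifs
    all_goals ring
  have hw : ∀ a b : Fin (n + 1) → ℂ,
      ∑ j : Fin n, ∑ k : Fin n, a j.succ * b k.succ * dzWedgeDzbar j.succ k.succ Z W =
      (∑ j : Fin n, a j.succ * Z j.succ) * (∑ k : Fin n, b k.succ * star (W k.succ))
        - (∑ j : Fin n, a j.succ * W j.succ) * (∑ k : Fin n, b k.succ * star (Z k.succ)) :=
    fun a b => sum_sum_dzWedgeDzbar (fun j => a j.succ) (fun j => b j.succ)
      (fun j => Z j.succ) (fun j => W j.succ)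
  have hw1 := hw z (fun j => star (z j))
  have hw2 := hw (fun j => star (z j)) z
  have hw3 := hw z z
  have hw4 := hw (fun j => star (z j)) (fun j => star (z j))
  congr 1
  simp only [hR, Finset.sum_add_distrib, Finset.sum_sub_distrib, ← Finset.mul_sum, hw1, hw2, hw3,
    hw4, hZ', hW', hZs, hWs, Finset.sum_ite_eq, Finset.mem_univ, if_true]
  rw [hL, sum_sum_dzWedgeDzbar]
  simp only [Fin.sum_univ_succ]
  have hd : dzWedgeDzbar 0 0 Z W = Z 0 * star (W 0) - W 0 * star (Z 0) := rfl
  rw [hd]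
  generalize ∑ j : Fin n, dzWedgeDzbar j.succ j.succ Z W = D
  generalize ∑ j : Fin n, star (z j.succ) * Z j.succ = A
  generalize ∑ j : Fin n, star (z j.succ) * W j.succ = B
  generalize ∑ j : Fin n, z j.succ * star (W j.succ) = A'
  generalize ∑ j : Fin n, z j.succ * star (Z j.succ) = B'
  field_simp
  ring

/-- The differential at `p` of the map `L → S^n ⊂ ℝ^{n+1}`, with values in `ℝ^{n+1}`. -/
def ambientDifferential {n : ℕ} (q : ℕ) {L : Type*} [TopologicalSpace L]
    [ChartedSpace (EuclideanSpace ℝ (Fin q)) L] (x : L → USphere n) (p : L) :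
    TangentSpace (𝓡 q) p →L[ℝ] Ambient n :=
  mfderiv (𝓡 q) 𝓘(ℝ, Ambient n) (fun p' => (x p' : Ambient n)) p

/-- Smooth `1`-forms on `L`: smooth sections of the cotangent bundle. -/
abbrev OneForm (q : ℕ) (L : Type*) [TopologicalSpace L]
    [ChartedSpace (EuclideanSpace ℝ (Fin q)) L] [IsManifold (𝓡 q) ∞ L] :=
  Cₛ^∞⟮𝓡 q; EuclideanSpace ℝ (Fin q) →L[ℝ] ℝ,
    fun p : L => TangentSpace (𝓡 q) p →L[ℝ] Bundle.Trivial L ℝ p⟯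

/-- The conormal space `N^*_p L = {ξ ∈ T^*_{x(p)} S^n : ξ ∘ d_p x = 0}`. -/
def conormalSpace {n : ℕ} (q : ℕ) {L : Type*} [TopologicalSpace L]
    [ChartedSpace (EuclideanSpace ℝ (Fin q)) L] (x : L → USphere n) (p : L) : Set (Ambient n) :=
  {ξ | ⟪(x p : Ambient n), ξ⟫_ℝ = 0 ∧ ∀ v, ⟪ξ, ambientDifferential q x p v⟫_ℝ = 0}

/-- The twisted conormal bundle `N^*L + μ`, as the set of pairs `(p, ξ + μ(p))` with `p ∈ L` and
`ξ ∈ N^*_p L`.  Here `T^*_p L` is regarded as a subspace of `T^*_{x(p)} S^n` in the usual way: the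
covector `μ(p)` on `T_p L ≅ d_p x (T_p L)` is extended by zero on the normal space, that is, it is
represented by the vector `m ∈ d_p x (T_p L)` with `⟨m, d_p x (v)⟩ = μ_p(v)`. -/
def twistedConormal {n q : ℕ} {L : Type*} [TopologicalSpace L]
    [ChartedSpace (EuclideanSpace ℝ (Fin q)) L] [IsManifold (𝓡 q) ∞ L]
    (x : L → USphere n) (μ : OneForm q L) : Set (L × Ambient n) :=
  {P | ∃ ξ ∈ conormalSpace q x P.1, ∃ m ∈ range (ambientDifferential q x P.1),
    (∀ v, ⟪m, ambientDifferential q x P.1 v⟫_ℝ = μ P.1 v) ∧ P.2 = ξ + m}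

/-- The immersion `(p, η) ↦ Ψ(x(p), η)` of the twisted conormal bundle into `Q ≅ T^*S^n`. -/
def toQuadricAlong {n : ℕ} {L : Type*} (x : L → USphere n) (P : L × Ambient n) :
    Fin (n + 1) → ℂ :=
  toQuadric ((x P.1 : Ambient n), P.2)

/-- `Z` is tangent at `P` to the image of the twisted conormal bundle in `Q ≅ T^*S^n`: it is the
velocity at time `0` of the image of a smooth curve `t ↦ (γ(t), η(t))` in `N^*L + μ` which passes
through `P` at time `0`. -/
def IsTangentAt {n q : ℕ} {L : Type*} [TopologicalSpace L]
    [ChartedSpace (EuclideanSpace ℝ (Fin q)) L] [IsManifold (𝓡 q) ∞ L]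
    (x : L → USphere n) (μ : OneForm q L) (P : L × Ambient n) (Z : Fin (n + 1) → ℂ) : Prop :=
  ∃ ε > 0, ∃ γ : ℝ → L, ∃ η : ℝ → Ambient n,
    ContMDiffOn 𝓘(ℝ, ℝ) (𝓡 q) ∞ γ (Ioo (-ε) ε) ∧ ContDiffOn ℝ ∞ η (Ioo (-ε) ε) ∧
    (∀ t ∈ Ioo (-ε) ε, (γ t, η t) ∈ twistedConormal x μ) ∧ (γ 0, η 0) = P ∧
    HasDerivAt (fun t => toQuadricAlong x (γ t, η t)) Z 0

/-- The `n`-dimensional immersed submanifold `N^*L + μ` (an affine bundle of rank `n - q` over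
`L^q`) of the `2n`-dimensional manifold `T^*S^n ≅ Q` is Lagrangian: `ω_St` vanishes on all its
tangent spaces. -/
def IsLagrangianTwist {n q : ℕ} {L : Type*} [TopologicalSpace L]
    [ChartedSpace (EuclideanSpace ℝ (Fin q)) L] [IsManifold (𝓡 q) ∞ L]
    (c : ℝ) (x : L → USphere n) (μ : OneForm q L) : Prop :=
  ∀ P ∈ twistedConormal x μ, ∀ Z W, IsTangentAt x μ P Z → IsTangentAt x μ P W →
    stenzelForm n c (toQuadricAlong x P) Z W = 0

end StenzelConormal
end

namespace StenzelConormal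


/-! Write `g(r) = v'(cosh 2r) cosh r (sinh r / r) = f'(2r) / (2r)`. Through `Ψ`, away from the zero
section, the Stenzel form is `-d(g(|ξ|) θ)` with `θ` the tautological 1-form, and `θ` restricts to
the pullback of `μ` on the twisted conormal bundle. Hence a fibre direction `ξ` and a lift of `a ∈
T_pL` pair at `η` to `-g'(|η|) (⟨η, ξ⟩ / |η|) μ(a)`. The proof computes this value directly, in
`stenzelForm_fibre_eq`, without introducing the primitive.

If `μ ≠ 0`, this is a nonzero value as soon as `g' > 0` and some `η` in the fibre has `⟨η, ξ⟩ > 0`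
for a conormal `ξ`. The second holds because `q < n` leaves room for a nonzero conormal vector. The
first is `f'(w) < w f''(w)`; by the Ricci-flat equation it becomes `n ∫_0^w sinh^{n-1} < w
sinh^{n-1} w`, true for `n ≥ 2` (`deriv_slope_quotient_pos`). For `n = 1` only `q = 0` occurs, where
every 1-form is zero.

If `μ = 0`, the `v''` term of the form vanishes on velocities of the conormal bundle, and the `v'`
term is the difference of the second derivative of the immersion, paired with `η`, taken in its two
orders. Symmetry of second derivatives kills it (`isLagrangianTwist_zero`). -/

/-! ### Monotonicity of `f'(w) / w` and the derivatives of the Stenzel potential -/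

theorem pos_of_hasDerivAt_pos {f f' : ℝ → ℝ} (hf : ∀ w, HasDerivAt f (f' w) w)
    (h0 : f 0 = 0) (hpos : ∀ w, 0 < w → 0 < f' w) {w : ℝ} (hw : 0 < w) : 0 < f w := by
  have hmono : StrictMonoOn f (Ici 0) := by
    refine strictMonoOn_of_deriv_pos (convex_Ici 0)
      (fun x _ => (hf x).continuousAt.continuousWithinAt) ?_
    intro x hx
    rw [interior_Ici] at hx
    rw [(hf x).deriv]
    exact hpos x hx
  have := hmono self_mem_Ici (mem_Ici.2 hw.le) hw
  rwa [h0] at this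

theorem sinh_lt_mul_cosh {w : ℝ} (hw : 0 < w) : Real.sinh w < w * Real.cosh w := by
  have h := pos_of_hasDerivAt_pos (f := fun t => t * Real.cosh t - Real.sinh t)
    (f' := fun t => t * Real.sinh t) (fun t => by
      have := ((hasDerivAt_id t).mul (Real.hasDerivAt_cosh t)).sub (Real.hasDerivAt_sinh t)
      refine this.congr_deriv ?_
      simp) (by simp) (fun t ht => mul_pos ht (Real.sinh_pos_iff.2 ht)) hw
  linarith

theorem continuous_sinh_pow (k : ℕ) : Continuous fun t => Real.sinh t ^ k :=
  Real.continuous_sinh.pow k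

theorem hasDerivAt_integral_sinh_pow (k : ℕ) (w : ℝ) :
    HasDerivAt (fun w => ∫ t in (0 : ℝ)..w, Real.sinh t ^ k) (Real.sinh w ^ k) w :=
  ((continuous_sinh_pow k).integral_hasStrictDerivAt 0 w).hasDerivAt

theorem integral_sinh_pow_pos (k : ℕ) {w : ℝ} (hw : 0 < w) :
    0 < ∫ t in (0 : ℝ)..w, Real.sinh t ^ k :=
  pos_of_hasDerivAt_pos (hasDerivAt_integral_sinh_pow k) (by simp)
    (fun _ ht => pow_pos (Real.sinh_pos_iff.2 ht) k) hw

/-- Both sides vanish at `0`, and the derivative of their difference is `k sinh^{k-1} t (t cosh t -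
sinh t) > 0`. For `k = 0` there is equality, which is where `n ≥ 2` enters. -/
theorem integral_sinh_pow_lt {k : ℕ} (hk : 0 < k) {w : ℝ} (hw : 0 < w) :
    (k + 1) * ∫ t in (0 : ℝ)..w, Real.sinh t ^ k < w * Real.sinh w ^ k := by
  have h := pos_of_hasDerivAt_pos
    (f := fun t => t * Real.sinh t ^ k - (k + 1) * ∫ s in (0 : ℝ)..t, Real.sinh s ^ k)
    (f' := fun t => k * Real.sinh t ^ (k - 1) * (t * Real.cosh t - Real.sinh t)) (fun t => by
      have := ((hasDerivAt_id t).mul ((Real.hasDerivAt_sinh t).pow k)).sub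
        ((hasDerivAt_integral_sinh_pow k t).const_mul (k + 1 : ℝ))
      refine this.congr_deriv ?_
      obtain ⟨j, rfl⟩ : ∃ j, k = j + 1 := ⟨k - 1, by omega⟩
      simp only [id, Nat.add_sub_cancel, Pi.pow_apply]
      push_cast
      ring) (by simp) (fun t ht => ?_) hw
  · linarith
  · have := sinh_lt_mul_cosh ht
    have h2 := pow_pos (Real.sinh_pos_iff.2 ht) (k - 1)
    have hk' : (0 : ℝ) < k := by exact_mod_cast hk
    exact mul_pos (mul_pos hk' h2) (by linarith)

/-- For `n ≥ 2` the function `w ↦ f'(w) / w` is strictly increasing on `(0, ∞)`. -/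
theorem exists_hasDerivAt_potentialSlope {n : ℕ} (hn : 2 ≤ n) {c : ℝ} (hc : 0 < c) {w : ℝ}
    (hw : 0 < w) :
    ∃ h', HasDerivAt (potentialSlope n c) h' w ∧ potentialSlope n c w < w * h' := by
  have hn0 : (0 : ℝ) < n := by exact_mod_cast (by omega : 0 < n)
  have hI := integral_sinh_pow_pos (n - 1) hw
  set J := n * c * ∫ t in (0 : ℝ)..w, Real.sinh t ^ (n - 1) with hJ
  have hJpos : 0 < J := by positivity
  have h1 := ((hasDerivAt_integral_sinh_pow (n - 1) w).const_mul (n * c)).rpow_const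
    (p := (1 / n : ℝ)) (Or.inl hJpos.ne')
  refine ⟨_, h1, ?_⟩
  have hs : potentialSlope n c w = J ^ (1 / n : ℝ) := rfl
  -- Pulling out the power that also occurs in the derivative of `J ^ (1 / n)` reduces the claim to
  -- `J < c w sinh^{n-1} w`.
  have hsplit : J ^ (1 / n : ℝ) = J * J ^ (1 / n - 1 : ℝ) := by
    rw [Real.rpow_sub_one hJpos.ne']
    field_simp
  rw [hs, ← hJ, hsplit]
  have hpos : 0 < J ^ (1 / n - 1 : ℝ) := by positivity
  have key := integral_sinh_pow_lt (k := n - 1) (by omega) hw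
  have hcast : ((n - 1 : ℕ) : ℝ) + 1 = n := by
    exact_mod_cast (by omega : n - 1 + 1 = n)
  rw [hcast] at key
  have hJlt : J < c * (w * Real.sinh w ^ (n - 1)) := by
    rw [hJ]
    nlinarith [mul_lt_mul_of_pos_left key hc]
  calc J * J ^ (1 / n - 1 : ℝ) < c * (w * Real.sinh w ^ (n - 1)) * J ^ (1 / n - 1 : ℝ) := by
        gcongr
    _ = _ := by field_simp

theorem hasDerivAt_arcosh_cosh {w : ℝ} (hw : 0 < w) :
    HasDerivAt Real.arcosh (Real.sinh w)⁻¹ (Real.cosh w) := by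
  have h := Real.hasDerivAt_arcosh (x := Real.cosh w) (Real.one_lt_cosh.2 hw.ne')
  rwa [← Real.sinh_arcosh (Real.one_lt_cosh.2 hw.ne').le, Real.arcosh_cosh hw.le] at h

theorem potentialD1_cosh {n : ℕ} (c : ℝ) {w : ℝ} (hw : 0 < w) :
    potentialD1 n c (Real.cosh w) = potentialSlope n c w / Real.sinh w := by
  have h1 : HasDerivAt (fun t => ∫ s in (0 : ℝ)..t, potentialSlope n c s)
      (potentialSlope n c w) (Real.arcosh (Real.cosh w)) := by
    rw [Real.arcosh_cosh hw.le]
    exact ((continuous_potentialSlope c).integral_hasStrictDerivAt 0 w).hasDerivAt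
  have h2 : HasDerivAt (stenzelPotential n c) _ (Real.cosh w) :=
    h1.comp _ (hasDerivAt_arcosh_cosh hw)
  rw [potentialD1, h2.hasDerivWithinAt.derivWithin
    (uniqueDiffOn_Ici 1 _ (Real.one_lt_cosh.2 hw.ne').le), div_eq_mul_inv]

theorem potentialD2_cosh {n : ℕ} {c h' w : ℝ} (hw : 0 < w)
    (hh : HasDerivAt (potentialSlope n c) h' w) :
    potentialD2 n c (Real.cosh w) =
      (h' * Real.sinh w - potentialSlope n c w * Real.cosh w) / Real.sinh w ^ 3 := by
  have hs := Real.sinh_pos_iff.2 hw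
  have h1 : HasDerivAt (fun t => potentialSlope n c t / Real.sinh t)
      ((h' * Real.sinh w - potentialSlope n c w * Real.cosh w) / Real.sinh w ^ 2)
      (Real.arcosh (Real.cosh w)) := by
    rw [Real.arcosh_cosh hw.le]
    exact hh.div (Real.hasDerivAt_sinh w) hs.ne'
  -- The closed formula for `potentialD1` holds on `τ > 1`, which is a neighbourhood of `cosh w`;
  -- the one-sided derivative there is the ordinary one.
  have h3 := (h1.comp _ (hasDerivAt_arcosh_cosh hw)).congr_of_eventuallyEq
    (f₁ := potentialD1 n c) (by
    filter_upwards [lt_mem_nhds (Real.one_lt_cosh.2 hw.ne')] with τ hτ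
    have := potentialD1_cosh (n := n) c (Real.arcosh_pos hτ)
    rwa [Real.cosh_arcosh hτ.le] at this)
  rw [potentialD2, h3.hasDerivWithinAt.derivWithin
    (uniqueDiffOn_Ici 1 _ (Real.one_lt_cosh.2 hw.ne').le)]
  field_simp

/-- The derivative of `r ↦ f'(2r) / (2r) = v'(cosh 2r) cosh r (sinh r / r)` is positive. -/
theorem deriv_slope_quotient_pos {n : ℕ} (hn : 2 ≤ n) {c : ℝ} (hc : 0 < c) {r : ℝ} (hr : 0 < r) :
    0 < potentialD1 n c (Real.cosh (2 * r)) *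
        ((r * Real.cosh r - Real.sinh r) / r ^ 2 * Real.cosh r + Real.sinh r / r * Real.sinh r) +
      potentialD2 n c (Real.cosh (2 * r)) *
        (2 * Real.sinh (2 * r) * (Real.sinh r / r) * Real.cosh r) := by
  obtain ⟨h', hh, hlt⟩ := exists_hasDerivAt_potentialSlope hn hc (w := 2 * r) (by positivity)
  have hs : 0 < Real.sinh r := Real.sinh_pos_iff.2 hr
  have hco := Real.cosh_pos r
  rw [potentialD1_cosh c (by positivity), potentialD2_cosh (by positivity) hh]
  have hsq := Real.cosh_sq r
  generalize potentialSlope n c (2 * r) = h at *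
  rw [Real.sinh_two_mul, Real.cosh_two_mul]
  generalize Real.sinh r = s at *
  generalize Real.cosh r = k at *
  -- The right-hand side is the quotient rule for `f'(2r) / (2r)`, with `h = f'(2r)` and `h' =
  -- f''(2r)`.
  have : h / (2 * s * k) * ((r * k - s) / r ^ 2 * k + s / r * s) +
      (h' * (2 * s * k) - h * (k ^ 2 + s ^ 2)) / (2 * s * k) ^ 3 *
        (2 * (2 * s * k) * (s / r) * k) = (2 * r * h' - h) / (2 * r ^ 2) := by
    field_simp
    ring
  rw [this]
  apply div_pos <;> [linarith; positivity]


/-! ### The Stenzel form in real and imaginary parts -/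

/-- The complex vector `X + iY`. -/
def complexify {n : ℕ} (X Y : Ambient n) : Fin (n + 1) → ℂ := fun k =>
  (X k : ℂ) + Complex.I * (Y k : ℂ)

/-- The real part of a complex vector. -/
def reVec {n : ℕ} (Z : Fin (n + 1) → ℂ) : Ambient n := WithLp.toLp 2 fun k => (Z k).re

/-- The imaginary part of a complex vector. -/
def imVec {n : ℕ} (Z : Fin (n + 1) → ℂ) : Ambient n := WithLp.toLp 2 fun k => (Z k).im

theorem complexify_reVec_imVec {n : ℕ} (Z : Fin (n + 1) → ℂ) :
    complexify (reVec Z) (imVec Z) = Z := by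
  funext k
  apply Complex.ext <;> simp [complexify, reVec, imVec]

theorem reVec_complexify {n : ℕ} (X Y : Ambient n) : reVec (complexify X Y) = X := by
  ext k
  simp [complexify, reVec]

theorem imVec_complexify {n : ℕ} (X Y : Ambient n) : imVec (complexify X Y) = Y := by
  ext k
  simp [complexify, imVec]

theorem toQuadric_eq_complexify {n : ℕ} (p : Ambient n × Ambient n) :
    toQuadric p = complexify (Real.cosh ‖p.2‖ • p.1) ((Real.sinh ‖p.2‖ / ‖p.2‖) • p.2) := by
  funext k
  simp only [toQuadric, complexify, PiLp.smul_apply, smul_eq_mul]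
  push_cast
  ring

theorem sqNorm_complexify {n : ℕ} (X Y : Ambient n) :
    sqNorm (complexify X Y) = ‖X‖ ^ 2 + ‖Y‖ ^ 2 := by
  rw [← sum_sq_eq_norm_sq, ← sum_sq_eq_norm_sq, ← Finset.sum_add_distrib, sqNorm]
  refine Finset.sum_congr rfl fun k _ => ?_
  simp [complexify, Complex.normSq_apply]
  ring

theorem inner_eq_sum {n : ℕ} (a b : Ambient n) : ⟪a, b⟫_ℝ = ∑ k, a k * b k := by
  simp [PiLp.inner_apply, mul_comm]

theorem sum_complexify_mul_star {n : ℕ} (X Y X' Y' : Ambient n) :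
    ∑ k, complexify X Y k * star (complexify X' Y' k) =
      ((⟪X, X'⟫_ℝ + ⟪Y, Y'⟫_ℝ : ℝ) : ℂ) + Complex.I * ((⟪Y, X'⟫_ℝ - ⟪X, Y'⟫_ℝ : ℝ) : ℂ) := by
  simp only [inner_eq_sum]
  push_cast
  rw [← Finset.sum_add_distrib, ← Finset.sum_sub_distrib, Finset.mul_sum,
    ← Finset.sum_add_distrib]
  refine Finset.sum_congr rfl fun k _ => ?_
  simp only [complexify, Complex.star_def, map_add, map_mul, Complex.conj_ofReal, Complex.conj_I]
  linear_combination (-(Y k : ℂ) * (Y' k : ℂ)) * Complex.I_sq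

/-- The diagonal part of the coefficient matrix gives `Z·W̄ - W·Z̄`, and the rank-one part gives
products of Hermitian pairings with `z`. Both are differences of complex conjugates, hence purely
imaginary, and the factor `i/2` makes the value real. -/
theorem stenzelForm_complexify {n : ℕ} (c : ℝ) (X Y X₁ Y₁ X₂ Y₂ : Ambient n) :
    stenzelForm n c (complexify X Y) (complexify X₁ Y₁) (complexify X₂ Y₂) =
      ((-(potentialD1 n c (‖X‖ ^ 2 + ‖Y‖ ^ 2) * (⟪Y₁, X₂⟫_ℝ - ⟪X₁, Y₂⟫_ℝ) +
        potentialD2 n c (‖X‖ ^ 2 + ‖Y‖ ^ 2) *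
          ((⟪X, Y₁⟫_ℝ - ⟪Y, X₁⟫_ℝ) * (⟪X, X₂⟫_ℝ + ⟪Y, Y₂⟫_ℝ) -
            (⟪X, X₁⟫_ℝ + ⟪Y, Y₁⟫_ℝ) * (⟪X, Y₂⟫_ℝ - ⟪Y, X₂⟫_ℝ))) : ℝ) : ℂ) := by
  rw [stenzelForm, sqNorm_complexify]
  generalize potentialD1 n c (‖X‖ ^ 2 + ‖Y‖ ^ 2) = d1
  generalize potentialD2 n c (‖X‖ ^ 2 + ‖Y‖ ^ 2) = d2
  generalize hz : complexify X Y = z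
  generalize hZ : complexify X₁ Y₁ = Z
  generalize hW : complexify X₂ Y₂ = W
  have hsplit : ∑ j, ∑ k, ((if j = k then (d1 : ℂ) else 0) + star (z j) * z k * (d2 : ℂ))
        * dzWedgeDzbar j k Z W =
      d1 * (∑ j, Z j * star (W j) - ∑ j, W j * star (Z j)) +
        d2 * ((∑ j, Z j * star (z j)) * (∑ k, z k * star (W k)) -
          (∑ j, W j * star (z j)) * (∑ k, z k * star (Z k))) := by
    have h := sum_sum_dzWedgeDzbar (fun j => star (z j)) z Z W
    simp only [mul_comm (star (z _)) (Z _), mul_comm (star (z _)) (W _)] at h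
    rw [← h, ← Finset.sum_sub_distrib]
    simp only [add_mul, Finset.sum_add_distrib, ite_mul, zero_mul, Finset.sum_ite_eq,
      Finset.mem_univ, if_true, Finset.mul_sum]
    congr 1
    refine Finset.sum_congr rfl fun j _ => Finset.sum_congr rfl fun k _ => ?_
    ring
  rw [hsplit]
  subst hz hZ hW
  simp only [sum_complexify_mul_star]
  rw [real_inner_comm X₁ X₂, real_inner_comm Y₁ Y₂, real_inner_comm Y₁ X₂, real_inner_comm X₁ Y₂,
    real_inner_comm X X₁, real_inner_comm Y Y₁, real_inner_comm X Y₁, real_inner_comm Y X₁,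
    real_inner_comm X X₂, real_inner_comm Y Y₂, real_inner_comm X Y₂, real_inner_comm Y X₂]
  push_cast
  ring_nf
  simp only [Complex.I_sq]
  ring

theorem hasDerivAt_toLp {m : ℕ} {f : ℝ → Fin m → ℝ} {f' : Fin m → ℝ} {t : ℝ}
    (h : HasDerivAt f f' t) :
    HasDerivAt (fun s => WithLp.toLp 2 (f s)) (WithLp.toLp 2 f') t :=
  (PiLp.hasFDerivAt_toLp (𝕜 := ℝ) 2 (f t)).comp_hasDerivAt t h

theorem hasDerivAt_euclidean_apply {m : ℕ} {f : ℝ → EuclideanSpace ℝ (Fin m)}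
    {f' : EuclideanSpace ℝ (Fin m)} {t : ℝ} (h : HasDerivAt f f' t) (k : Fin m) :
    HasDerivAt (fun s => f s k) (f' k) t :=
  (PiLp.hasFDerivAt_apply (𝕜 := ℝ) 2 (f t) k).comp_hasDerivAt t h

theorem hasDerivAt_reVec {n : ℕ} {z : ℝ → Fin (n + 1) → ℂ} {Z : Fin (n + 1) → ℂ} {t : ℝ}
    (h : HasDerivAt z Z t) : HasDerivAt (fun s => reVec (z s)) (reVec Z) t :=
  hasDerivAt_toLp (hasDerivAt_pi.2 fun k =>
    Complex.reCLM.hasFDerivAt.comp_hasDerivAt t (hasDerivAt_pi.1 h k))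

theorem hasDerivAt_imVec {n : ℕ} {z : ℝ → Fin (n + 1) → ℂ} {Z : Fin (n + 1) → ℂ} {t : ℝ}
    (h : HasDerivAt z Z t) : HasDerivAt (fun s => imVec (z s)) (imVec Z) t :=
  hasDerivAt_toLp (hasDerivAt_pi.2 fun k =>
    Complex.imCLM.hasFDerivAt.comp_hasDerivAt t (hasDerivAt_pi.1 h k))

theorem hasDerivAt_complexify {n : ℕ} {X Y : ℝ → Ambient n} {X' Y' : Ambient n} {t : ℝ}
    (hX : HasDerivAt X X' t) (hY : HasDerivAt Y Y' t) :
    HasDerivAt (fun s => complexify (X s) (Y s)) (complexify X' Y') t :=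
  hasDerivAt_pi.2 fun k => ((hasDerivAt_euclidean_apply hX k).ofReal_comp).add
    (((hasDerivAt_euclidean_apply hY k).ofReal_comp).const_mul Complex.I)


/-! ### The immersion, the 1-form and the twisted conormal bundle in a chart -/

section Chart

variable {n q : ℕ} {L : Type*} [TopologicalSpace L]
  [ChartedSpace (EuclideanSpace ℝ (Fin q)) L] [IsManifold (𝓡 q) ∞ L]

/-- The map `x : L → ℝ^{n+1}` in the preferred chart at `p`. -/
noncomputable def chartedMap (q : ℕ) {L : Type*} [TopologicalSpace L]
    [ChartedSpace (EuclideanSpace ℝ (Fin q)) L] (x : L → USphere n) (p : L)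
    (u : EuclideanSpace ℝ (Fin q)) : Ambient n :=
  x ((extChartAt (𝓡 q) p).symm u)

/-- The differential of the inverse of the preferred chart at `p`. -/
noncomputable def chartFrame (p : L) (u : EuclideanSpace ℝ (Fin q)) :
    EuclideanSpace ℝ (Fin q) →L[ℝ] TangentSpace (𝓡 q) ((extChartAt (𝓡 q) p).symm u) :=
  mfderivWithin 𝓘(ℝ, EuclideanSpace ℝ (Fin q)) (𝓡 q) (extChartAt (𝓡 q) p).symm (range (𝓡 q)) u

/-- The `1`-form `μ` in the preferred chart at `p`. -/
noncomputable def chartedForm (μ : OneForm q L) (p : L) (u : EuclideanSpace ℝ (Fin q)) :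
    EuclideanSpace ℝ (Fin q) →L[ℝ] ℝ :=
  ContinuousLinearMap.comp (show TangentSpace (𝓡 q) ((extChartAt (𝓡 q) p).symm u) →L[ℝ] ℝ from
    μ ((extChartAt (𝓡 q) p).symm u)) (chartFrame p u)

theorem chartFrame_surjective (p : L) {u : EuclideanSpace ℝ (Fin q)}
    (hu : u ∈ (extChartAt (𝓡 q) p).target) : Surjective (chartFrame p u) :=
  (isInvertible_mfderivWithin_extChartAt_symm hu).bijective.2

theorem chartFrame_injective (p : L) {u : EuclideanSpace ℝ (Fin q)}
    (hu : u ∈ (extChartAt (𝓡 q) p).target) : Injective (chartFrame p u) :=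
  (isInvertible_mfderivWithin_extChartAt_symm hu).bijective.1

theorem contMDiff_coe_uSphere (n : ℕ) :
    ContMDiff (𝓡 n) 𝓘(ℝ, Ambient n) ∞ ((↑) : USphere n → Ambient n) :=
  have : Fact (Module.finrank ℝ (Ambient n) = n + 1) := ⟨finrank_euclideanSpace_fin⟩
  contMDiff_coe_sphere

theorem mfderiv_coe_uSphere_injective {n : ℕ} (y : USphere n) :
    Injective (mfderiv (𝓡 n) 𝓘(ℝ, Ambient n) ((↑) : USphere n → Ambient n) y) := by
  have : Fact (Module.finrank ℝ (Ambient n) = n + 1) := ⟨finrank_euclideanSpace_fin⟩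
  convert! injective_mvfderiv_subtypeVal_sphere (n := n) y

omit [IsManifold (𝓡 q) ∞ L] in
theorem contMDiff_coe_comp {x : L → USphere n} (hx : ContMDiff (𝓡 q) (𝓡 n) ∞ x) :
    ContMDiff (𝓡 q) 𝓘(ℝ, Ambient n) ∞ (fun p => (x p : Ambient n)) :=
  (contMDiff_coe_uSphere n).comp hx

theorem contDiffOn_chartedMap {x : L → USphere n} (hx : ContMDiff (𝓡 q) (𝓡 n) ∞ x) (p : L) :
    ContDiffOn ℝ ∞ (chartedMap q x p) (extChartAt (𝓡 q) p).target := by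
  rw [← contMDiffOn_iff_contDiffOn]
  exact (contMDiff_coe_comp hx).comp_contMDiffOn (contMDiffOn_extChartAt_symm p)

theorem fderiv_chartedMap {x : L → USphere n} (hx : ContMDiff (𝓡 q) (𝓡 n) ∞ x) (p : L)
    {u : EuclideanSpace ℝ (Fin q)} (hu : u ∈ (extChartAt (𝓡 q) p).target)
    (a : EuclideanSpace ℝ (Fin q)) :
    fderiv ℝ (chartedMap q x p) u a =
      ambientDifferential q x ((extChartAt (𝓡 q) p).symm u) (chartFrame p u a) := by
  have h := mfderiv_comp_mfderivWithin (I := 𝓘(ℝ, EuclideanSpace ℝ (Fin q))) (I' := 𝓡 q)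
    (I'' := 𝓘(ℝ, Ambient n)) (f := (extChartAt (𝓡 q) p).symm) (s := range (𝓡 q))
    (g := fun p => (x p : Ambient n)) u
    ((contMDiff_coe_comp hx).mdifferentiableAt (by simp))
    (mdifferentiableWithinAt_extChartAt_symm hu)
    ((𝓡 q).uniqueMDiffOn _ (extChartAt_target_subset_range p hu))
  have h2 : mfderivWithin 𝓘(ℝ, EuclideanSpace ℝ (Fin q)) 𝓘(ℝ, Ambient n) (chartedMap q x p)
      (range (𝓡 q)) u = fderiv ℝ (chartedMap q x p) u := by
    rw [mfderivWithin_eq_fderivWithin, ModelWithCorners.range_eq_univ, fderivWithin_univ]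
  rw [← h2]
  exact congrArg (fun A => A a) h

omit [IsManifold (𝓡 q) ∞ L] in
theorem ambientDifferential_injective {x : L → USphere n} (hx : ContMDiff (𝓡 q) (𝓡 n) ∞ x)
    (hximm : ∀ p, Injective (mfderiv (𝓡 q) (𝓡 n) x p)) (p : L) :
    Injective (ambientDifferential q x p) := by
  have h : ambientDifferential q x p =
      (mfderiv (𝓡 n) 𝓘(ℝ, Ambient n) ((↑) : USphere n → Ambient n) (x p)).comp
        (mfderiv (𝓡 q) (𝓡 n) x p) :=
    mfderiv_comp p ((contMDiff_coe_uSphere n).mdifferentiableAt (by simp))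
      (hx.mdifferentiableAt (by simp))
  rw [h]
  exact (mfderiv_coe_uSphere_injective (x p)).comp (hximm p)

omit [IsManifold (𝓡 q) ∞ L] in
theorem inner_chartedMap_self (x : L → USphere n) (p : L) (u : EuclideanSpace ℝ (Fin q)) :
    ⟪chartedMap q x p u, chartedMap q x p u⟫_ℝ = 1 := by
  rw [real_inner_self_eq_norm_sq, chartedMap, norm_eq_of_mem_sphere]
  norm_num

theorem inner_chartedMap_fderiv {x : L → USphere n} (hx : ContMDiff (𝓡 q) (𝓡 n) ∞ x) (p : L)
    {u : EuclideanSpace ℝ (Fin q)} (hu : u ∈ (extChartAt (𝓡 q) p).target)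
    (a : EuclideanSpace ℝ (Fin q)) :
    ⟪chartedMap q x p u, fderiv ℝ (chartedMap q x p) u a⟫_ℝ = 0 := by
  have hd : HasFDerivAt (chartedMap q x p) (fderiv ℝ (chartedMap q x p) u) u :=
    (((contDiffOn_chartedMap hx p).contDiffAt ((isOpen_extChartAt_target (I := 𝓡 q) p).mem_nhds hu)
      ).differentiableAt (by simp)).hasFDerivAt
  have h1 := hd.inner ℝ hd
  have h2 : HasFDerivAt (fun u => ⟪chartedMap q x p u, chartedMap q x p u⟫_ℝ)
      (0 : EuclideanSpace ℝ (Fin q) →L[ℝ] ℝ) u := by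
    simp only [inner_chartedMap_self]
    exact hasFDerivAt_const _ _
  have h3 := congrArg (fun A => A a) (h1.unique h2)
  simp only [ContinuousLinearMap.comp_apply, ContinuousLinearMap.prod_apply,
    fderivInnerCLM_apply, zero_apply] at h3
  rw [real_inner_comm (chartedMap q x p u) (fderiv ℝ (chartedMap q x p) u a)] at h3
  linarith

/-- This is the derivative of `|x|² = 1`, taken in the preferred chart at `p`. -/
theorem inner_ambientDifferential {x : L → USphere n} (hx : ContMDiff (𝓡 q) (𝓡 n) ∞ x) (p : L)
    (v : TangentSpace (𝓡 q) p) : ⟪(x p : Ambient n), ambientDifferential q x p v⟫_ℝ = 0 := by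
  have hu := mem_extChartAt_target (I := 𝓡 q) p
  have hinv := extChartAt_to_inv (I := 𝓡 q) p
  -- The type of `v` depends on the base point, so the claim is stated at the image of `p` under the
  -- chart and back, and only then rewritten to `p`.
  have key : ∀ v : TangentSpace (𝓡 q) ((extChartAt (𝓡 q) p).symm (extChartAt (𝓡 q) p p)),
      ⟪(x ((extChartAt (𝓡 q) p).symm (extChartAt (𝓡 q) p p)) : Ambient n),
        ambientDifferential q x _ v⟫_ℝ = 0 := by
    intro v
    obtain ⟨a, rfl⟩ := chartFrame_surjective p hu v
    rw [← fderiv_chartedMap hx p hu]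
    exact inner_chartedMap_fderiv hx p hu a
  rw [hinv] at key
  exact key v

/-- The splitting into conormal and tangential parts is recovered by orthogonal projection to the
image of the differential. Each fibre is thus cut out by affine equations, which can be
differentiated along curves. -/
theorem mem_twistedConormal_iff {x : L → USphere n} (hx : ContMDiff (𝓡 q) (𝓡 n) ∞ x)
    (μ : OneForm q L) (p : L) (η : Ambient n) :
    (p, η) ∈ twistedConormal x μ ↔
      ⟪(x p : Ambient n), η⟫_ℝ = 0 ∧ ∀ v, ⟪η, ambientDifferential q x p v⟫_ℝ = μ p v := by
  constructor
  · rintro ⟨ξ, ⟨h1, h2⟩, m, ⟨w, rfl⟩, h3, h4⟩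
    simp only at h1 h2 h3 h4
    rw [h4]
    refine ⟨?_, fun v => ?_⟩
    · rw [inner_add_right, h1, inner_ambientDifferential hx, add_zero]
    · rw [inner_add_left, h2, h3, zero_add]
  · rintro ⟨h1, h2⟩
    let K : Submodule ℝ (Ambient n) := LinearMap.range (ambientDifferential q x p).toLinearMap
    obtain ⟨w, hw⟩ : K.starProjection η ∈ K := Submodule.starProjection_apply_mem K η
    have hperp : ∀ v, ⟪η - K.starProjection η, ambientDifferential q x p v⟫_ℝ = 0 := fun v =>
      (Submodule.mem_orthogonal' K _).1 (Submodule.sub_starProjection_mem_orthogonal η) _ ⟨v, rfl⟩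
    refine ⟨η - K.starProjection η, ⟨?_, hperp⟩, K.starProjection η, ⟨w, hw⟩, fun v => ?_, ?_⟩
    · rw [inner_sub_right, h1, ← hw]
      simpa using inner_ambientDifferential hx p w
    · have := hperp v
      rw [inner_sub_left, h2, sub_eq_zero] at this
      exact this.symm
    · simp

theorem mem_twistedConormal_chart_iff {x : L → USphere n} (hx : ContMDiff (𝓡 q) (𝓡 n) ∞ x)
    (μ : OneForm q L) (p : L) {u : EuclideanSpace ℝ (Fin q)}
    (hu : u ∈ (extChartAt (𝓡 q) p).target) (η : Ambient n) :
    ((extChartAt (𝓡 q) p).symm u, η) ∈ twistedConormal x μ ↔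
      ⟪chartedMap q x p u, η⟫_ℝ = 0 ∧
        ∀ a, ⟪η, fderiv ℝ (chartedMap q x p) u a⟫_ℝ = chartedForm μ p u a := by
  rw [mem_twistedConormal_iff hx, (chartFrame_surjective p hu).forall]
  simp only [fderiv_chartedMap hx p hu]
  rfl

theorem fderiv_chartedMap_injective {x : L → USphere n} (hx : ContMDiff (𝓡 q) (𝓡 n) ∞ x)
    (hximm : ∀ p, Injective (mfderiv (𝓡 q) (𝓡 n) x p)) (p : L)
    {u : EuclideanSpace ℝ (Fin q)} (hu : u ∈ (extChartAt (𝓡 q) p).target) :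
    Injective (fderiv ℝ (chartedMap q x p) u) := by
  intro a b hab
  rw [fderiv_chartedMap hx p hu, fderiv_chartedMap hx p hu] at hab
  exact chartFrame_injective p hu (ambientDifferential_injective hx hximm _ hab)

/-- Smoothness of the section `μ` means smoothness in the trivialization of the cotangent bundle at
`p`, and there the inverse tangent trivialization is `chartFrame`. -/
theorem contDiffOn_chartedForm (μ : OneForm q L) (p : L) :
    ContDiffOn ℝ ∞ (chartedForm μ p) (extChartAt (𝓡 q) p).target := by
  rw [← contMDiffOn_iff_contDiffOn]
  let e := trivializationAt (EuclideanSpace ℝ (Fin q) →L[ℝ] ℝ)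
    (fun p : L => TangentSpace (𝓡 q) p →L[ℝ] Bundle.Trivial L ℝ p) p
  have hmem : ∀ u ∈ (extChartAt (𝓡 q) p).target,
      (extChartAt (𝓡 q) p).symm u ∈ (chartAt (EuclideanSpace ℝ (Fin q)) p).source := by
    intro u hu
    rw [← extChartAt_source (𝓡 q)]
    exact (extChartAt (𝓡 q) p).map_target hu
  have h1 := μ.contMDiff.comp_contMDiffOn (contMDiffOn_extChartAt_symm (n := ∞) (I := 𝓡 q) p)
  have h2 := ((e.contMDiffOn_iff (fun u hu => by
    rw [e.mem_source]
    simpa [e] using hmem u hu)).1 h1).2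
  refine h2.congr fun u hu => ?_
  have h3 := TangentBundle.symmL_trivializationAt (𝕜 := ℝ) (I := 𝓡 q) (hmem u hu)
  rw [(extChartAt (𝓡 q) p).right_inv hu] at h3
  simp only [chartedForm, chartFrame, ← h3]
  simp only [e, comp_apply, hom_trivializationAt_apply, ContinuousLinearMap.inCoordinates]
  ext a
  simp

end Chart


/-! ### The untwisted conormal bundle is Lagrangian -/

section Twist

variable {n q : ℕ} {L : Type*} [TopologicalSpace L]
  [ChartedSpace (EuclideanSpace ℝ (Fin q)) L] [IsManifold (𝓡 q) ∞ L]

theorem chartedForm_zero_apply (p : L) (u a : EuclideanSpace ℝ (Fin q)) :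
    chartedForm (0 : OneForm q L) p u a = 0 := rfl

/-- The tangent vectors to a conormal bundle, in terms of the first and second derivatives of the
immersion in a chart. -/
theorem exists_chart_velocity {x : L → USphere n} (hx : ContMDiff (𝓡 q) (𝓡 n) ∞ x)
    {P : L × Ambient n} {Z : Fin (n + 1) → ℂ} (hZ : IsTangentAt x (0 : OneForm q L) P Z) :
    ∃ (u' : EuclideanSpace ℝ (Fin q)) (s : ℝ),
      reVec Z = s • chartedMap q x P.1 (extChartAt (𝓡 q) P.1 P.1) +
        Real.cosh ‖P.2‖ •
          fderiv ℝ (chartedMap q x P.1) (extChartAt (𝓡 q) P.1 P.1) u' ∧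
      ⟪imVec Z, chartedMap q x P.1 (extChartAt (𝓡 q) P.1 P.1)⟫_ℝ = 0 ∧
      ∀ a, ⟪imVec Z, fderiv ℝ (chartedMap q x P.1) (extChartAt (𝓡 q) P.1 P.1) a⟫_ℝ =
        -⟪(Real.sinh ‖P.2‖ / ‖P.2‖) • P.2,
          fderiv ℝ (fderiv ℝ (chartedMap q x P.1)) (extChartAt (𝓡 q) P.1 P.1) u' a⟫_ℝ := by
  obtain ⟨ε, hε, γ, η, hγ, -, hmem, rfl, hder⟩ := hZ
  simp only
  set p := γ 0 with hp
  set φ := extChartAt (𝓡 q) p with hφ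
  set F := chartedMap q x p with hF
  have hu0 : φ p ∈ φ.target := mem_extChartAt_target p
  have h0 : Ioo (-ε) ε ∈ nhds (0 : ℝ) := Ioo_mem_nhds (by linarith) hε
  have hγ0 : ContMDiffAt 𝓘(ℝ, ℝ) (𝓡 q) ∞ γ 0 := hγ.contMDiffAt h0
  have hu : ContDiffAt ℝ ∞ (fun t => φ (γ t)) 0 := by
    rw [← contMDiffAt_iff_contDiffAt]
    exact (contMDiffAt_extChartAt (I := 𝓡 q) (x := p)).comp (0 : ℝ) hγ0
  have hu' := (hu.differentiableAt (by simp)).hasDerivAt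
  generalize deriv (fun t => φ (γ t)) 0 = u' at hu'
  have hFs : ContDiffAt ℝ ∞ F (φ p) :=
    (contDiffOn_chartedMap hx p).contDiffAt ((isOpen_extChartAt_target (I := 𝓡 q) p).mem_nhds hu0)
  have hFd : HasFDerivAt F (fderiv ℝ F (φ p)) (φ p) := (hFs.differentiableAt (by simp)).hasFDerivAt
  have hFd2 : HasFDerivAt (fderiv ℝ F) (fderiv ℝ (fderiv ℝ F) (φ p)) (φ p) :=
    ((hFs.fderiv_right (m := 1) (by norm_cast)).differentiableAt (by simp)).hasFDerivAt
  have hFu : HasDerivAt (fun t => F (φ (γ t))) (fderiv ℝ F (φ p) u') 0 :=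
    HasFDerivAt.comp_hasDerivAt (l := F) (0 : ℝ) hFd hu'
  have hF2u : HasDerivAt (fun t => fderiv ℝ F (φ (γ t))) (fderiv ℝ (fderiv ℝ F) (φ p) u') 0 :=
    hFd2.comp_hasDerivAt (0 : ℝ) hu'
  have hsrc : ∀ᶠ t in nhds (0 : ℝ), γ t ∈ φ.source :=
    hγ0.continuousAt.eventually_mem (extChartAt_source_mem_nhds p)
  have hx_eq : ∀ t, γ t ∈ φ.source → (x (γ t) : Ambient n) = F (φ (γ t)) := by
    intro t ht
    rw [hF, chartedMap, ← hφ, φ.left_inv ht]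
  have hconormal : ∀ᶠ t in nhds (0 : ℝ), ⟪F (φ (γ t)), η t⟫_ℝ = 0 ∧
      ∀ a, ⟪η t, fderiv ℝ F (φ (γ t)) a⟫_ℝ = 0 := by
    filter_upwards [hsrc, h0] with t ht ht2
    have h1 := hmem t ht2
    rw [← φ.left_inv ht] at h1
    have h2 := (mem_twistedConormal_chart_iff hx 0 p (φ.map_source ht) (η t)).1 h1
    exact ⟨h2.1, fun a => (h2.2 a).trans (chartedForm_zero_apply p _ a)⟩
  have hX : HasDerivAt (fun t => Real.cosh ‖η t‖ • F (φ (γ t))) (reVec Z) 0 := by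
    refine (hasDerivAt_reVec hder).congr_of_eventuallyEq ?_
    filter_upwards [hsrc] with t ht
    simp only [toQuadricAlong, toQuadric_eq_complexify, reVec_complexify, hx_eq t ht]
  have hY : HasDerivAt (fun t => (Real.sinh ‖η t‖ / ‖η t‖) • η t) (imVec Z) 0 := by
    refine (hasDerivAt_imVec hder).congr_of_eventuallyEq (Eventually.of_forall fun t => ?_)
    simp only [toQuadricAlong, toQuadric_eq_complexify, imVec_complexify]
  -- Pairing with the unit vector `F` exhibits `cosh ‖η t‖` as differentiable at `0` without
  -- differentiating the norm, so `η 0 = 0` needs no separate case. Its derivative is the witness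
  -- `s`.
  have hρ := hX.inner ℝ hFu
  have hself : ∀ u, ⟪F u, F u⟫_ℝ = 1 := inner_chartedMap_self x p
  simp only [inner_smul_left, hself, mul_one, RCLike.conj_to_real] at hρ
  have hX2 := hX.unique (hρ.smul hFu)
  -- The fibre equations `⟨Y, F⟩ = 0` and then `⟨Y, dF a⟩ = 0` are differentiated along the curve;
  -- the second one produces the second derivative of `F`.
  have hYF := (hY.inner ℝ hFu).unique ((hasDerivAt_const (0 : ℝ) (0 : ℝ)).congr_of_eventuallyEq (by
    filter_upwards [hconormal] with t ht
    rw [inner_smul_left, real_inner_comm, ht.1, mul_zero]))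
  have hYD : ∀ a, ⟪(Real.sinh ‖η 0‖ / ‖η 0‖) • η 0,
      fderiv ℝ (fderiv ℝ F) (φ p) u' a + fderiv ℝ F (φ p) 0⟫_ℝ +
        ⟪imVec Z, fderiv ℝ F (φ p) a⟫_ℝ = 0 := fun a => (hY.inner ℝ (hF2u.clm_apply (hasDerivAt_const (0 : ℝ) a))).unique
    ((hasDerivAt_const (0 : ℝ) (0 : ℝ)).congr_of_eventuallyEq (by
      filter_upwards [hconormal] with t ht
      rw [inner_smul_left, ht.2, mul_zero]))
  refine ⟨u', _, hX2.trans (add_comm _ _), ?_, fun a => ?_⟩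
  · rw [inner_smul_left, hconormal.self_of_nhds.2, mul_zero, zero_add] at hYF
    exact hYF
  · have := hYD a
    simp only [map_zero, add_zero] at this
    linarith

/-- In the `v''` term each summand contains a factor `⟨X, Y_i⟩ - ⟨Y, X_i⟩`, zero because `Y_i ⊥ F`
and `η` is orthogonal to `F` and to the range of `dF`. The `v'` term compares `⟨η, D²F(u₁, u₂)⟩`
with `⟨η, D²F(u₂, u₁)⟩`. -/
theorem isLagrangianTwist_zero {x : L → USphere n} (hx : ContMDiff (𝓡 q) (𝓡 n) ∞ x) (c : ℝ) :
    IsLagrangianTwist c x (0 : OneForm q L) := by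
  rintro ⟨p, η⟩ hP Z W hZ hW
  obtain ⟨u₁, s₁, hX₁, hF₁, hD₁⟩ := exists_chart_velocity hx hZ
  obtain ⟨u₂, s₂, hX₂, hF₂, hD₂⟩ := exists_chart_velocity hx hW
  simp only at hX₁ hF₁ hD₁ hX₂ hF₂ hD₂
  have hu0 := mem_extChartAt_target (I := 𝓡 q) p
  have hP' : ((extChartAt (𝓡 q) p).symm (extChartAt (𝓡 q) p p), η) ∈
      twistedConormal x (0 : OneForm q L) := by
    rwa [extChartAt_to_inv]
  have hxF : (x p : Ambient n) = chartedMap q x p (extChartAt (𝓡 q) p p) := by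
    rw [chartedMap, extChartAt_to_inv]
  rw [mem_twistedConormal_chart_iff hx _ p hu0] at hP'
  have hsymm : IsSymmSndFDerivAt ℝ (chartedMap q x p) (extChartAt (𝓡 q) p p) :=
    ((contDiffOn_chartedMap hx p).contDiffAt
      ((isOpen_extChartAt_target (I := 𝓡 q) p).mem_nhds hu0)).isSymmSndFDerivAt (by
        rw [minSmoothness_of_isRCLikeNormedField]
        exact WithTop.coe_le_coe.2 (le_top : (2 : ℕ∞) ≤ ⊤))
  obtain ⟨hηF, hηD⟩ := hP'
  replace hηD : ∀ a, ⟪η, fderiv ℝ (chartedMap q x p) (extChartAt (𝓡 q) p p) a⟫_ℝ = 0 :=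
    fun a => (hηD a).trans (chartedForm_zero_apply p _ a)
  rw [← complexify_reVec_imVec Z, ← complexify_reVec_imVec W, toQuadricAlong,
    toQuadric_eq_complexify, stenzelForm_complexify, hX₁, hX₂, hxF]
  have hs := hsymm u₁ u₂
  generalize chartedMap q x p (extChartAt (𝓡 q) p p) = F at *
  rw [real_inner_comm] at hηF
  simp only [inner_add_right, inner_smul_left, inner_smul_right, hF₁, hF₂, hD₁,
    hD₂, real_inner_comm (imVec W), real_inner_comm (imVec Z) F, hηF, hηD, hs,
    RCLike.conj_to_real]
  simp

end Twist


/-! ### Smooth solutions of the fibre equations, and existence of conormal vectors -/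

section LinearAlgebra

variable {E V : Type*} [NormedAddCommGroup E] [InnerProductSpace ℝ E] [FiniteDimensional ℝ E]
  [NormedAddCommGroup V] [InnerProductSpace ℝ V]

/-- The pullback `b ↦ (a ↦ ⟨A b, A a⟩)` of the inner product by a linear map. -/
noncomputable def gram (A : E →L[ℝ] V) : E →L[ℝ] E →L[ℝ] ℝ :=
  ((ContinuousLinearMap.compL ℝ E V ℝ).flip A).comp ((innerSL ℝ).comp A)

omit [FiniteDimensional ℝ E] in
theorem gram_apply (A : E →L[ℝ] V) (b a : E) : gram A b a = ⟪A b, A a⟫_ℝ := rfl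

omit [FiniteDimensional ℝ E] in
theorem contDiff_gram : ContDiff ℝ ∞ (gram : (E →L[ℝ] V) → _) :=
  (ContinuousLinearMap.contDiff _).clm_comp (contDiff_const.clm_comp contDiff_id)

theorem isInvertible_gram {A : E →L[ℝ] V} (hA : Injective A) : (gram A).IsInvertible := by
  have hinj : Injective (gram A) := by
    rw [injective_iff_map_eq_zero]
    intro b hb
    have h : ⟪A b, A b⟫_ℝ = 0 := by rw [← gram_apply, hb]; rfl
    rw [inner_self_eq_zero] at h
    exact hA (h.trans (map_zero A).symm)
  have hdim : Module.finrank ℝ E = Module.finrank ℝ (E →L[ℝ] ℝ) :=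
    (InnerProductSpace.toDual ℝ E).toLinearEquiv.finrank_eq
  let e := LinearEquiv.ofInjectiveOfFinrankEq (gram A).toLinearMap hinj hdim
  exact ⟨e.toContinuousLinearEquiv, by ext; rfl⟩

/-- The vector obtained from `ζ` by prescribing its inner products `ℓ` with the range of `A` and
removing its component along `y`. -/
noncomputable def adjust (A : E →L[ℝ] V) (ℓ : E →L[ℝ] ℝ) (y ζ : V) : V :=
  ζ + A ((gram A).inverse (ℓ - (innerSL ℝ ζ).comp A)) - ⟪y, ζ⟫_ℝ • y

theorem inner_adjust {A : E →L[ℝ] V} (hA : Injective A) (ℓ : E →L[ℝ] ℝ) {y : V}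
    (hy : ∀ a, ⟪y, A a⟫_ℝ = 0) (ζ : V) (a : E) : ⟪adjust A ℓ y ζ, A a⟫_ℝ = ℓ a := by
  have h := (isInvertible_gram hA).self_apply_inverse (ℓ - (innerSL ℝ ζ).comp A)
  have h2 := congrArg (fun B => B a) h
  simp only [gram_apply] at h2
  rw [adjust, inner_sub_left, inner_add_left, h2, inner_smul_left, hy]
  simp

omit [FiniteDimensional ℝ E] in
theorem inner_adjust_normal (A : E →L[ℝ] V) (ℓ : E →L[ℝ] ℝ) {y : V}
    (hy : ∀ a, ⟪y, A a⟫_ℝ = 0) (h1 : ⟪y, y⟫_ℝ = 1) (ζ : V) : ⟪y, adjust A ℓ y ζ⟫_ℝ = 0 := by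
  rw [adjust, inner_sub_right, inner_add_right, hy, inner_smul_right, h1]
  ring

omit [FiniteDimensional ℝ E] in
theorem adjust_eq_self {A : E →L[ℝ] V} {ℓ : E →L[ℝ] ℝ} {y ζ : V} (h : ⟪y, ζ⟫_ℝ = 0)
    (hζ : ∀ a, ⟪ζ, A a⟫_ℝ = ℓ a) : adjust A ℓ y ζ = ζ := by
  have : ℓ - (innerSL ℝ ζ).comp A = 0 := by
    ext a
    simp [hζ]
  rw [adjust, this, h]
  simp

/-- Inversion of linear maps is smooth at invertible ones, and `gram` of an injective map is
invertible. This is what turns a single vector `ζ` into a smooth local section of the twisted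
conormal bundle. -/
theorem contDiffOn_adjust {U : Type*} [NormedAddCommGroup U] [NormedSpace ℝ U] {s : Set U}
    {A : U → E →L[ℝ] V} {ℓ : U → E →L[ℝ] ℝ} {y : U → V} (hA : ContDiffOn ℝ ∞ A s)
    (hinj : ∀ u ∈ s, Injective (A u)) (hℓ : ContDiffOn ℝ ∞ ℓ s) (hy : ContDiffOn ℝ ∞ y s) (ζ : V) :
    ContDiffOn ℝ ∞ (fun u => adjust (A u) (ℓ u) (y u) ζ) s := by
  have hinv : ContDiffOn ℝ ∞ (fun u => (gram (A u)).inverse) s := fun u hu =>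
    ContDiffAt.comp_contDiffWithinAt (g := ContinuousLinearMap.inverse)
      (f := fun u => gram (A u)) u (isInvertible_gram (hinj u hu)).contDiffAt_map_inverse
      (contDiff_gram.contDiffAt.comp_contDiffWithinAt u (hA u hu))
  exact (contDiffOn_const.add (hA.clm_apply (hinv.clm_apply
    (hℓ.sub (contDiffOn_const.clm_comp hA))))).sub ((hy.inner ℝ contDiffOn_const).smul hy)

end LinearAlgebra

/-- A codimension count: there is a nonzero vector orthogonal to `y` and to the range of `A`. -/
theorem exists_ne_zero_conormal {n q : ℕ} (hqn : q < n)
    (A : EuclideanSpace ℝ (Fin q) →L[ℝ] Ambient n) (y : Ambient n) :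
    ∃ ξ : Ambient n, ξ ≠ 0 ∧ ⟪y, ξ⟫_ℝ = 0 ∧ ∀ a, ⟪ξ, A a⟫_ℝ = 0 := by
  -- The map `ξ ↦ (⟨y, ξ⟩, A* ξ)` goes from dimension `n + 1` to dimension `q + 1`, so it has a
  -- kernel.
  let T : Ambient n →ₗ[ℝ] ℝ × EuclideanSpace ℝ (Fin q) :=
    (innerSL ℝ y).toLinearMap.prod (ContinuousLinearMap.adjoint A).toLinearMap
  have hker : LinearMap.ker T ≠ ⊥ := by
    apply LinearMap.ker_ne_bot_of_finrank_lt
    simp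
    omega
  obtain ⟨ξ, hξ, hne⟩ := Submodule.exists_mem_ne_zero_of_ne_bot hker
  obtain ⟨h1, h2⟩ := Prod.mk.inj (LinearMap.mem_ker.1 hξ)
  refine ⟨ξ, hne, h1, fun a => ?_⟩
  rw [← ContinuousLinearMap.adjoint_inner_left]
  have h3 : ContinuousLinearMap.adjoint A ξ = 0 := h2
  rw [h3, inner_zero_left]

/-! ### Velocities in the quadric and the value of the form on a fibre direction -/

/-- Away from the zero section `r = ‖η‖` is differentiable with `r' = ⟨η, η'⟩ / r`; the rest is the
product rule. -/
theorem hasDerivAt_toQuadric {n : ℕ} {y η : ℝ → Ambient n} {y' η' : Ambient n} {t : ℝ}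
    (hy : HasDerivAt y y' t) (hη : HasDerivAt η η' t) (h0 : η t ≠ 0) :
    HasDerivAt (fun s => toQuadric (y s, η s))
      (complexify
        (Real.cosh ‖η t‖ • y' + (Real.sinh ‖η t‖ * (⟪η t, η'⟫_ℝ / ‖η t‖)) • y t)
        ((Real.sinh ‖η t‖ / ‖η t‖) • η' + ((‖η t‖ * Real.cosh ‖η t‖ - Real.sinh ‖η t‖) /
          ‖η t‖ ^ 2 * (⟪η t, η'⟫_ℝ / ‖η t‖)) • η t)) t := by
  have hr0 : ‖η t‖ ≠ 0 := norm_ne_zero_iff.2 h0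
  have hr : HasDerivAt (fun s => ‖η s‖) (⟪η t, η'⟫_ℝ / ‖η t‖) t := by
    have h := hη.norm_sq.sqrt (by positivity)
    simp only [Real.sqrt_sq (norm_nonneg _)] at h
    refine h.congr_deriv ?_
    field_simp
  simp only [toQuadric_eq_complexify]
  refine hasDerivAt_complexify (hr.cosh.smul hy) ?_
  refine ((hr.sinh.div hr hr0).smul hη).congr_deriv ?_
  congr 2
  field_simp

/-- The value of the Stenzel form on the velocity of a fibre and another tangent vector. -/
theorem stenzelForm_fibre_eq {n : ℕ} (c : ℝ) {x ξ η w η₂ : Ambient n} {k : ℝ} (hη : η ≠ 0)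
    (hxx : ⟪x, x⟫_ℝ = 1) (hxξ : ⟪x, ξ⟫_ℝ = 0) (hxη : ⟪x, η⟫_ℝ = 0) (hxw : ⟪x, w⟫_ℝ = 0)
    (hξw : ⟪ξ, w⟫_ℝ = 0) (hηw : ⟪η, w⟫_ℝ = k) (hxη₂ : ⟪x, η₂⟫_ℝ = -k) :
    stenzelForm n c (toQuadric (x, η))
      (complexify (Real.cosh ‖η‖ • (0 : Ambient n) + (Real.sinh ‖η‖ * (⟪η, ξ⟫_ℝ / ‖η‖)) • x)
        ((Real.sinh ‖η‖ / ‖η‖) • ξ + ((‖η‖ * Real.cosh ‖η‖ - Real.sinh ‖η‖) /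
          ‖η‖ ^ 2 * (⟪η, ξ⟫_ℝ / ‖η‖)) • η))
      (complexify (Real.cosh ‖η‖ • w + (Real.sinh ‖η‖ * (⟪η, η₂⟫_ℝ / ‖η‖)) • x)
        ((Real.sinh ‖η‖ / ‖η‖) • η₂ + ((‖η‖ * Real.cosh ‖η‖ - Real.sinh ‖η‖) /
          ‖η‖ ^ 2 * (⟪η, η₂⟫_ℝ / ‖η‖)) • η)) =
      ((-(k * (⟪η, ξ⟫_ℝ / ‖η‖) * (potentialD1 n c (Real.cosh (2 * ‖η‖)) *
        ((‖η‖ * Real.cosh ‖η‖ - Real.sinh ‖η‖) / ‖η‖ ^ 2 * Real.cosh ‖η‖ +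
          Real.sinh ‖η‖ / ‖η‖ * Real.sinh ‖η‖) +
      potentialD2 n c (Real.cosh (2 * ‖η‖)) *
        (2 * Real.sinh (2 * ‖η‖) * (Real.sinh ‖η‖ / ‖η‖) * Real.cosh ‖η‖))) : ℝ) : ℂ) := by
  have hr : 0 < ‖η‖ := norm_pos_iff.2 hη
  have hnx : ‖x‖ = 1 := by
    rw [← sq_eq_sq₀ (norm_nonneg _) zero_le_one, ← real_inner_self_eq_norm_sq, hxx, one_pow]
  -- Here `|z|² = cosh² r + sinh² r = cosh 2r`, which is why the potential is evaluated at `w = 2r`.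
  have hsq : ‖Real.cosh ‖η‖ • x‖ ^ 2 + ‖(Real.sinh ‖η‖ / ‖η‖) • η‖ ^ 2 =
      Real.cosh (2 * ‖η‖) := by
    rw [norm_smul, norm_smul, mul_pow, mul_pow, Real.norm_eq_abs, Real.norm_eq_abs, sq_abs, sq_abs,
      hnx, Real.cosh_two_mul]
    field_simp
  rw [toQuadric_eq_complexify, stenzelForm_complexify, hsq]
  norm_cast
  have hηη : ⟪η, η⟫_ℝ = ‖η‖ ^ 2 := real_inner_self_eq_norm_sq η
  have hηx : ⟪η, x⟫_ℝ = 0 := by rw [real_inner_comm, hxη]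
  have hξx : ⟪ξ, x⟫_ℝ = 0 := by rw [real_inner_comm, hxξ]
  simp only [smul_zero, zero_add, inner_add_left, inner_add_right, inner_smul_left,
    inner_smul_right, RCLike.conj_to_real, hxx, hxξ, hxη, hxw, hξw, hηw, hxη₂, hηη, hηx, hξx]
  rw [Real.sinh_two_mul]
  have hcs := Real.cosh_sq ‖η‖
  generalize potentialD1 n c _ = d1
  generalize potentialD2 n c _ = d2
  generalize ⟪η, ξ⟫_ℝ = A
  generalize ⟪η, η₂⟫_ℝ = B
  generalize Real.sinh ‖η‖ = s at *
  generalize Real.cosh ‖η‖ = h at *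
  generalize ‖η‖ = r at *
  field_simp
  ring


/-! ### A Lagrangian twist has zero 1-form -/

section Converse

variable {n q : ℕ} {L : Type*} [TopologicalSpace L]
  [ChartedSpace (EuclideanSpace ℝ (Fin q)) L] [IsManifold (𝓡 q) ∞ L]

/-- In a chart, every point of the twisted conormal bundle lies on a smooth local section. -/
theorem exists_local_section {x : L → USphere n} (hx : ContMDiff (𝓡 q) (𝓡 n) ∞ x)
    (hximm : ∀ p, Injective (mfderiv (𝓡 q) (𝓡 n) x p)) (μ : OneForm q L) (p : L)
    (ζ : Ambient n) :
    ∃ H : EuclideanSpace ℝ (Fin q) → Ambient n,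
      ContDiffOn ℝ ∞ H (extChartAt (𝓡 q) p).target ∧
      (∀ u ∈ (extChartAt (𝓡 q) p).target,
        ((extChartAt (𝓡 q) p).symm u, H u) ∈ twistedConormal x μ) ∧
      ((p, ζ) ∈ twistedConormal x μ → H (extChartAt (𝓡 q) p p) = ζ) := by
  have hopen := isOpen_extChartAt_target (I := 𝓡 q) p
  have hF := contDiffOn_chartedMap hx p
  have hinj : ∀ u ∈ (extChartAt (𝓡 q) p).target, Injective (fderiv ℝ (chartedMap q x p) u) :=
    fun u hu => fderiv_chartedMap_injective hx hximm p hu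
  refine ⟨fun u => adjust (fderiv ℝ (chartedMap q x p) u) (chartedForm μ p u)
    (chartedMap q x p u) ζ, ?_, fun u hu => ?_, fun hζ => ?_⟩
  · exact contDiffOn_adjust (hF.fderiv_of_isOpen hopen (by simp)) hinj (contDiffOn_chartedForm μ p)
      hF ζ
  · rw [mem_twistedConormal_chart_iff hx μ p hu]
    exact ⟨inner_adjust_normal _ _ (inner_chartedMap_fderiv hx p hu)
      (inner_chartedMap_self x p u) ζ,
      inner_adjust (hinj u hu) _ (inner_chartedMap_fderiv hx p hu) ζ⟩
  · rw [← extChartAt_to_inv (I := 𝓡 q) p,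
      mem_twistedConormal_chart_iff hx μ p (mem_extChartAt_target p)] at hζ
    exact adjust_eq_self hζ.1 hζ.2

/-- The form is tested at one well-chosen `η` over `p`, on a velocity along the fibre and a velocity
along a local section lying over the direction `a`. The value is `-μ(a)` times positive factors. -/
theorem chartedForm_apply_eq_zero_of_isLagrangianTwist {c : ℝ} (hc : 0 < c) (hn : 2 ≤ n)
    (hqn : q < n) {x : L → USphere n} (hx : ContMDiff (𝓡 q) (𝓡 n) ∞ x)
    (hximm : ∀ p, Injective (mfderiv (𝓡 q) (𝓡 n) x p)) {μ : OneForm q L}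
    (hL : IsLagrangianTwist c x μ) (p : L) (a : EuclideanSpace ℝ (Fin q)) :
    chartedForm μ p (extChartAt (𝓡 q) p p) a = 0 := by
  set φ := extChartAt (𝓡 q) p with hφ
  set F := chartedMap q x p with hF
  have hopen : IsOpen φ.target := isOpen_extChartAt_target p
  have hu0 : φ p ∈ φ.target := mem_extChartAt_target p
  have hinv : φ.symm (φ p) = p := extChartAt_to_inv p
  have hxF : (x p : Ambient n) = F (φ p) := by rw [hF, chartedMap, ← hφ, hinv]
  have hmem : ∀ ζ, (p, ζ) ∈ twistedConormal x μ ↔ ⟪F (φ p), ζ⟫_ℝ = 0 ∧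
      ∀ a, ⟪ζ, fderiv ℝ F (φ p) a⟫_ℝ = chartedForm μ p (φ p) a := by
    intro ζ
    have h := mem_twistedConormal_chart_iff hx μ p hu0 ζ
    rwa [← hφ, hinv] at h
  obtain ⟨ξ, hξ0, hxξ, hξA⟩ := exists_ne_zero_conormal hqn (fderiv ℝ F (φ p)) (F (φ p))
  have hξξ : 0 < ⟪ξ, ξ⟫_ℝ := real_inner_self_pos.2 hξ0
  obtain ⟨η, hη, hηξ⟩ : ∃ η, (p, η) ∈ twistedConormal x μ ∧ 0 < ⟪η, ξ⟫_ℝ := by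
    obtain ⟨H₀, -, hH₀, -⟩ := exists_local_section hx hximm μ p 0
    have h1 := hH₀ (φ p) hu0
    rw [← hφ, hinv, hmem] at h1
    -- The coefficient is chosen so that `⟨η, ξ⟩ = ⟨ξ, ξ⟩`. Then `η ≠ 0`, and `‖η‖` has nonzero
    -- derivative in the direction `ξ`.
    refine ⟨H₀ (φ p) + (1 - ⟪H₀ (φ p), ξ⟫_ℝ / ⟪ξ, ξ⟫_ℝ) • ξ, (hmem _).2 ⟨?_, fun a => ?_⟩, ?_⟩
    · rw [inner_add_right, inner_smul_right, h1.1, hxξ]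
      ring
    · rw [inner_add_left, inner_smul_left, h1.2, hξA]
      ring
    · rw [inner_add_left, inner_smul_left, RCLike.conj_to_real, sub_mul,
        div_mul_cancel₀ _ hξξ.ne']
      linarith
  have hη0 : η ≠ 0 := by
    rintro rfl
    simp at hηξ
  obtain ⟨H, hHs, hH, hH0⟩ := exists_local_section hx hximm μ p η
  replace hH0 : H (φ p) = η := hH0 hη
  have hη' := (hmem η).1 hη
  have hline : ContDiff ℝ ∞ fun t : ℝ => φ p + t • a :=
    contDiff_const.add (contDiff_id.smul contDiff_const)
  have hlined : HasDerivAt (fun t : ℝ => φ p + t • a) a 0 := by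
    simpa using ((hasDerivAt_id (0 : ℝ)).smul_const a).const_add (φ p)
  have hline0 : φ p + (0 : ℝ) • a = φ p := by simp
  obtain ⟨ε, hε, hball⟩ := Metric.isOpen_iff.1 (hopen.preimage hline.continuous) 0
    (by simpa using hu0)
  rw [Real.ball_eq_Ioo, zero_sub, zero_add] at hball
  have hFd : HasFDerivAt F (fderiv ℝ F (φ p)) (φ p) :=
    (((contDiffOn_chartedMap hx p).contDiffAt (hopen.mem_nhds hu0)).differentiableAt
      (by simp)).hasFDerivAt
  have hHd : HasFDerivAt H (fderiv ℝ H (φ p)) (φ p) :=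
    ((hHs.contDiffAt (hopen.mem_nhds hu0)).differentiableAt (by simp)).hasFDerivAt
  have hFt : HasDerivAt (fun t : ℝ => F (φ p + t • a)) (fderiv ℝ F (φ p) a) 0 :=
    HasFDerivAt.comp_hasDerivAt_of_eq (l := F) (0 : ℝ) hFd hlined hline0.symm
  have hHt : HasDerivAt (fun t : ℝ => H (φ p + t • a)) (fderiv ℝ H (φ p) a) 0 :=
    HasFDerivAt.comp_hasDerivAt_of_eq (l := H) (0 : ℝ) hHd hlined hline0.symm
  -- Differentiating `⟨F, H⟩ = 0` along the line in direction `a` moves the derivative onto `F`,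
  -- where `⟨η, dF a⟩ = μ(a)`.
  have hFH : ⟪F (φ p), fderiv ℝ H (φ p) a⟫_ℝ = -chartedForm μ p (φ p) a := by
    have h1 := hFt.inner ℝ hHt
    have h2 := h1.unique ((hasDerivAt_const (0 : ℝ) (0 : ℝ)).congr_of_eventuallyEq (by
      filter_upwards [Ioo_mem_nhds (by linarith : -ε < 0) hε] with t ht
      exact ((mem_twistedConormal_chart_iff hx μ p (hball ht) _).1 (hH _ (hball ht))).1))
    simp only [hline0, hH0] at h2
    rw [real_inner_comm η, hη'.2] at h2
    linarith
  -- `Z` comes from the curve `η + t ξ` in the fibre over the fixed point `p`, `W` from the section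
  -- `H` over the line `φ p + t a`.
  have hZ := hasDerivAt_toQuadric (t := 0) (hasDerivAt_const (0 : ℝ) (F (φ p)))
    (η := fun t => η + t • ξ) (η' := ξ)
    (by simpa using ((hasDerivAt_id (0 : ℝ)).smul_const ξ).const_add η) (by simpa using hη0)
  have hW := hasDerivAt_toQuadric hFt hHt (by rwa [hline0, hH0])
  simp only [hH0, zero_smul, add_zero] at hZ hW
  have hTZ : ∀ Z, HasDerivAt (fun t : ℝ => toQuadric (F (φ p), η + t • ξ)) Z 0 →
      IsTangentAt x μ (p, η) Z := by
    intro Z hZ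
    refine ⟨1, one_pos, fun _ => p, fun t => η + t • ξ, contMDiffOn_const,
      (contDiff_const.add (contDiff_id.smul contDiff_const)).contDiffOn, fun t _ => ?_, by simp, ?_⟩
    · refine (hmem _).2 ⟨?_, fun a => ?_⟩
      · rw [inner_add_right, inner_smul_right, hη'.1, hxξ]
        ring
      · rw [inner_add_left, inner_smul_left, hη'.2, hξA]
        ring
    · simpa only [toQuadricAlong, hxF] using hZ
  have hTW : ∀ W, HasDerivAt (fun t : ℝ => toQuadric (F (φ p + t • a), H (φ p + t • a))) W 0 →
      IsTangentAt x μ (p, η) W := by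
    intro W hW
    refine ⟨ε, hε, fun t => φ.symm (φ p + t • a), fun t => H (φ p + t • a), ?_,
      hHs.comp hline.contDiffOn hball, fun t ht => hH _ (hball ht), by
        simp only [hline0, hinv, hH0], ?_⟩
    · exact (contMDiffOn_extChartAt_symm (I := 𝓡 q) p).comp hline.contMDiff.contMDiffOn hball
    · exact hW
  have hform := hL (p, η) hη _ _ (hTZ _ hZ) (hTW _ hW)
  rw [toQuadricAlong, hxF, stenzelForm_fibre_eq c (k := chartedForm μ p (φ p) a) hη0
    (inner_chartedMap_self x p _) hxξ hη'.1 (inner_chartedMap_fderiv hx p hu0 a) (hξA a)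
    (hη'.2 a) hFH, Complex.ofReal_eq_zero, neg_eq_zero] at hform
  have hpos := deriv_slope_quotient_pos hn hc (norm_pos_iff.2 hη0)
  have hr : 0 < ⟪η, ξ⟫_ℝ / ‖η‖ := div_pos hηξ (norm_pos_iff.2 hη0)
  rcases mul_eq_zero.1 hform with h | h
  · exact (mul_eq_zero.1 h).resolve_right hr.ne'
  · exact absurd h hpos.ne'

theorem eq_zero_of_chartedForm_eq_zero {μ : OneForm q L}
    (h : ∀ p a, chartedForm μ p (extChartAt (𝓡 q) p p) a = 0) : μ = 0 := by
  ext p v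
  have hall : ∀ w, μ ((extChartAt (𝓡 q) p).symm (extChartAt (𝓡 q) p p)) w = 0 := by
    intro w
    obtain ⟨a, rfl⟩ := chartFrame_surjective p (mem_extChartAt_target p) w
    exact h p a
  rw [extChartAt_to_inv] at hall
  exact hall v

end Converse

end StenzelConormal

theorem mainTheorem1 (n q : ℕ) (hqn : q < n) (c : ℝ) (hc : 0 < c)
    (L : Type*) [TopologicalSpace L] [ChartedSpace (EuclideanSpace ℝ (Fin q)) L]
    [IsManifold (𝓡 q) ∞ L]
    (x : L → StenzelConormal.USphere n) (hx : ContMDiff (𝓡 q) (𝓡 n) ∞ x)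
    (hximm : ∀ p, Injective (mfderiv (𝓡 q) (𝓡 n) x p))
    (μ : StenzelConormal.OneForm q L) :
    StenzelConormal.IsLagrangianTwist c x μ ↔ μ = 0 := by
  constructor
  · intro hL
    refine StenzelConormal.eq_zero_of_chartedForm_eq_zero fun p a => ?_
    -- For `q = 0` the tangent space is trivial. This covers `n = 1`, where `f'(w) / w` is constant
    -- and the monotonicity argument fails; `0 < q < n` gives `n ≥ 2`.
    rcases Nat.eq_zero_or_pos q with rfl | hq
    · rw [Subsingleton.elim a 0, map_zero]
    · exact StenzelConormal.chartedForm_apply_eq_zero_of_isLagrangianTwist hc (by omega) hqn hx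
        hximm hL p a
  · rintro rfl
    exact StenzelConormal.isLagrangianTwist_zero hx c
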